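/- \textbf{Setting.} Let $\mathcal G$ be a causal diagram (finite vertex set $V$, directed edges without directed cycles, and bidirected edges) and let $Y\in V$ be the reward variable. All variables of $V$ have finite domains, and the values of $Y$ are non-negative reals. A structural causal model (SCM) with diagram $\mathcal G$ has finitely many mutually independent exogenous variables with arbitrary laws. Each $v\in V$ is a function of its parents in $\mathcal G$ and of some of the exogenous variables, and two distinct variables may share an exogenous variable only if a bidirected edge joins them. Write $P_x$ for the law under $do(X=x)$, and write $Q[C](v)=P_{v\setminus c}(c)$ for $C\subseteq V$. Let $\mathcal M^*$ be a target SCM and let $\mathcal M^1,\dots,\mathcal M^n$ be source SCMs, all with diagram $\mathcal G$ and the same variables. For each $i$, $\mathcal M^i$ and $\mathcal M^*$ may differ only in the mechanisms (functions and laws of exogenous arguments) of the variables in a set $\Delta^i\subseteq V$. In source $i$ the experiments $do(Z)$ with $Z\in\mathbb Z^i$ have been conducted. Quantities of $\mathcal M^*$ and $\mathcal M^i$ carry the superscripts $*$ and $i$. \textbf{MIS, POMIS, POIS.} For $N\subseteq V$ (the non-manipulable variables), a set $X\subseteq V\setminus(\{Y\}\cup N)$ is called allowed under $N$. For $X'\subseteq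 X$, the sets $X$ and $X'$ are equivalent if $\mathbb E_{P_x}Y=\mathbb E_{P_{x[X']}}Y$ for every SCM with diagram $\mathcal G$ (over any finite domains) and every $x\in\Omega_X$. An allowed set is an MIS with respect to $\langle\mathcal G,Y,N\rangle$ if it is equivalent to none of its proper subsets. An MIS $X$ is a POMIS, written $X\in\mathbb P^N_{\mathcal G,Y}$, if some SCM with diagram $\mathcal G$ has an $x\in\Omega_X$ with $\mathbb E_{P_x}Y>\mathbb E_{P_w}Y$ for all $w\in\Omega_W$ and all MISs $W\ne X$ with respect to $\langle\mathcal G,Y,N\rangle$. An allowed set $R$ of ancestors of $Y$ is a POIS with associated POMIS $R^\dagger$ if $R^\dagger\in\mathbb P^N_{\mathcal G,Y}$, $R^\dagger\subseteq R$, and $R$ and $R^\dagger$ are equivalent. \textbf{Causal bounds.} Let $X\subseteq V\setminus\{Y\}$ and $x\in\Omega_X$. Let $Y^+$ be the set of ancestors of $Y$ (including $Y$) after the edges out of $X$ are deleted, and let $C_1,\dots,C_m$ be the maximal c-components of $\mathcal G[Y^+]$. A choice $\kappa$ assigns to each $C_q$ a source $i_q$ with $C_q\cap\Delta^{i_q}=\emptyset$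 and a set $C_q'\supseteq C_q$ such that $Q[C'_q]$ is identifiable in $\mathcal G$ from the interventional law $P_z(V)$ for some $Z\in\mathbb Z^{i_q}$. Identifiable means that any two SCMs with diagram $\mathcal G$ whose laws $P_z(V)$ agree and are positive have the same $Q[C_q']$. The causal bounds of $do(x)$ are $$\ell_x=\max\Big\{0,\ \max_{\kappa,w}\ \sum_{y^+}y\prod_{q}Q^{i_q}[C'_q]\Big\},$$ $$u_x=\min_{\kappa,w}\ \sum_y y\,\min\Big\{1,\sum_{y^+\setminus y}\prod_{q}\Big(Q^{i_q}[C'_q]+1-\sum_{c_q}Q^{i_q}[C'_q]\Big)\Big\},$$ where $w$ ranges over the values of the variables outside $X\cup Y^+$. If there is no choice, then $\ell_x=0$ and $u_x=\infty$. \textbf{Theorem (dominance bounds).} Let $N^*\subseteq V$ be the constraint in the target. Put $$\ell^*=\max\{\ell_w : w\in\Omega_W,\ W\text{ an MIS with respect to }\langle\mathcal G,Y,N^*\rangle\},$$ and for $N\subseteq N^*$ put $$u^*_N=\max\{u_r : r\in\Omega_R,\ R\in\mathbb P^N_{\mathcal G,Y}\}.$$ Let $\mu^*=\max\{\mathbb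 E_{P^*_x}Y : x\in\Omega_X,\ X\text{ allowed under }N^*\}$ be the optimal target reward. Then $\mu^*$ is also the maximum of $\mathbb E_{P^*_x}Y$ over $x\in\Omega_X$ with $X\in\mathbb P^{N^*}_{\mathcal G,Y}$, and for every $N\subseteq N^*$ $$\ell^*\le\mu^*\le u^*_N .$$ Moreover, for every $N\subseteq N^*$ and every family $\mathcal F$ of subsets of $V$ that contains, for each $R^\dagger\in\mathbb P^N_{\mathcal G,Y}$, at least one POIS with respect to $\langle\mathcal G,Y,N\rangle$ whose associated POMIS is $R^\dagger$, we have $$\mu^*\le\max\{u_r : r\in\Omega_R,\ R\in\mathcal F\}.$$ In particular this holds for the family of all POISs $R$ with $R^\dagger\in\mathbb P^N_{\mathcal G,Y}$. -/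

import Mathlib

/-- A causal diagram (acyclic directed mixed graph): directed edges `dir v w` (read `v → w`) without
directed cycles, and bidirected edges `bi v w` standing for unobserved confounders. -/
structure CausalDiagram (V : Type) where
  dir : V → V → Prop
  bi : V → V → Prop
  acyclic : ∀ v, ¬ Relation.TransGen dir v v
  bi_symm : ∀ v w, bi v w → bi w v

theorem CausalDiagram.wf {V : Type} [Finite V] (G : CausalDiagram V) : WellFounded G.dir := by
  have : Std.Irrefl (Relation.TransGen G.dir) := ⟨G.acyclic⟩
  exact (Finite.wellFounded_of_trans_of_irrefl (Relation.TransGen G.dir)).mono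
    (fun _ _ h => Relation.TransGen.single h)

/-- Joint values `Ω_S` of the variables in `S`. -/
abbrev Assign {V : Type} (Ω : V → Type) (S : Finset V) : Type := (v : S) → Ω v

/-- The exogenous side of a structural causal model with diagram `G`: finitely many exogenous
variables `e` with value spaces `U e`; `reads v` is the set of exogenous variables that are arguments
of the mechanism of `v`. Two distinct endogenous variables may share an exogenous variable
only if they are joined by a bidirected edge. -/
structure Exogenous {V : Type} (G : CausalDiagram V) where
  E : Type
  [fintypeE : Fintype E]
  U : E → Type
  [measurableU : ∀ e, MeasurableSpace (U e)]
  reads : V → Set E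
  share : ∀ v w e, v ≠ w → e ∈ reads v → e ∈ reads w → G.bi v w

attribute [instance] Exogenous.fintypeE Exogenous.measurableU

/-- A structural causal model with diagram `G`, endogenous domains `Ω` and exogenous variables `B`:
mutually independent exogenous variables with laws `P e`, and mechanisms
`v ← f v (parents of v) (exogenous arguments of v)`. -/
structure SCM {V : Type} (G : CausalDiagram V) (Ω : V → Type) (B : Exogenous G) where
  P : (e : B.E) → MeasureTheory.Measure (B.U e)
  [prob : ∀ e, MeasureTheory.IsProbabilityMeasure (P e)]
  f : (v : V) → ((w : {w // G.dir w v}) → Ω w) → ((e : {e // e ∈ B.reads v}) → B.U e) → Ω v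
  measurable_f : ∀ v pa (o : Ω v), MeasurableSet {u | f v pa u = o}

attribute [instance] SCM.prob

section Model

variable {V : Type} [Fintype V] [DecidableEq V] {G : CausalDiagram V} {Ω : V → Type}
  {B : Exogenous G}

/-- The potential response: the solution of the model for the unit `u` under `do(X = x)`. -/
noncomputable def SCM.solve (M : SCM G Ω B) (X : Finset V) (x : Assign Ω X)
    (u : (e : B.E) → B.U e) : (v : V) → Ω v :=
  G.wf.fix (C := Ω) (fun v ih =>
    if h : v ∈ X then x ⟨v, h⟩
    else M.f v (fun w => ih w.1 w.2) (fun e => u e.1))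

/-- The joint law `P(U)` of the exogenous variables. -/
noncomputable def SCM.law (M : SCM G Ω B) : MeasureTheory.Measure ((e : B.E) → B.U e) :=
  MeasureTheory.Measure.pi M.P

/-- `E_{P_x} Y = ∑_y y P_x(y)`; the real number encoded by the value `o` of `Y` is `r o`. -/
noncomputable def SCM.reward (M : SCM G Ω B) {Y : V} [Fintype (Ω Y)] (r : Ω Y → ℝ)
    (X : Finset V) (x : Assign Ω X) : ℝ :=
  ∑ o : Ω Y, r o * M.law.real {u | M.solve X x u Y = o}

/-- The c-factor `Q[C](v) = P_{v∖c}(c)`. In particular `Q[V∖Z](v) = P_z(v∖z)` is the joint law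
of the endogenous variables in the experiment `do(Z = z)`. -/
noncomputable def SCM.Q (M : SCM G Ω B) (C : Finset V) (v : (a : V) → Ω a) : ℝ :=
  M.law.real {u | ∀ c ∈ C, M.solve Cᶜ (fun a => v a) u c = v c}

/-- A source model `M` and the target model `T` differ at most in the mechanisms of the variables in
`D`: every other variable has the same function and the same law of its exogenous arguments. -/
def SCM.DiffersOnlyOn (M T : SCM G Ω B) (D : Finset V) : Prop :=
  ∀ v, v ∉ D → M.f v = T.f v ∧ ∀ e ∈ B.reads v, M.P e = T.P e

end Model

section Graph

variable {V : Type} [Fintype V] [DecidableEq V]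

open scoped Classical in
/-- The ancestors of `Y` (including `Y`) once all edges out of `X` are deleted. -/
noncomputable def CausalDiagram.ancestors (G : CausalDiagram V) (X : Finset V) (Y : V) : Finset V :=
  Finset.univ.filter (fun v => Relation.ReflTransGen (fun a b => G.dir a b ∧ a ∉ X) v Y)

open scoped Classical in
/-- The maximal c-components of the induced subgraph `G[S]`. -/
noncomputable def CausalDiagram.cComponents (G : CausalDiagram V) (S : Finset V) :
    Finset (Finset V) :=
  S.image (fun v => S.filter (fun w =>
    Relation.ReflTransGen (fun a b => G.bi a b ∧ a ∈ S ∧ b ∈ S) v w))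

/-- `X' ⊆ X` is equivalent to `X`: in every model with diagram `G`, over all finite domains,
`do(x)` and `do(x[X'])` have the same expected reward. -/
def EquivalentIn (G : CausalDiagram V) (Y : V) (X' X : Finset V) (h : X' ⊆ X) : Prop :=
  ∀ (Ω : V → Type) [∀ v, Fintype (Ω v)] (B : Exogenous G) (M : SCM G Ω B) (r : Ω Y → ℝ)
    (x : Assign Ω X), M.reward r X x = M.reward r X' (fun v => x ⟨v.1, h v.2⟩)

/-- The intervention sets that are allowed when the variables in `N` are non-manipulable. -/
def Allowed (Y : V) (N X : Finset V) : Prop := Y ∉ X ∧ Disjoint X N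

/-- Minimal intervention sets with respect to `⟨G, Y, N⟩`. -/
def IsMIS (G : CausalDiagram V) (Y : V) (N X : Finset V) : Prop :=
  Allowed Y N X ∧ ∀ (X' : Finset V) (h : X' ⊂ X), ¬ EquivalentIn G Y X' X h.subset

/-- Possibly-optimal minimal intervention sets with respect to `⟨G, Y, N⟩`: in some model with
diagram `G` the best action on `X` is strictly better than every action on every other MIS. -/
def IsPOMIS (G : CausalDiagram V) (Y : V) (N X : Finset V) : Prop :=
  IsMIS G Y N X ∧
    ∃ (Ω : V → Type) (_ : ∀ v, Fintype (Ω v)) (B : Exogenous G) (M : SCM G Ω B) (r : Ω Y → ℝ)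
      (x : Assign Ω X), ∀ W, IsMIS G Y N W → W ≠ X → ∀ w : Assign Ω W,
        M.reward r W w < M.reward r X x

/-- `R` is a possibly-optimal intervention set with respect to `⟨G, Y, N⟩` whose equivalent POMIS
is `R'`. -/
def IsPOISOver (G : CausalDiagram V) (Y : V) (N R R' : Finset V) : Prop :=
  Allowed Y N R ∧ R ⊆ G.ancestors ∅ Y ∧ IsPOMIS G Y N R' ∧ ∃ h : R' ⊆ R, EquivalentIn G Y R' R h

/-- `Q[C]` is identifiable in `G` from the experiment on `Z`: two models with diagram `G` that have the
same positive interventional distributions `P_z(V)` have the same `Q[C]`. -/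
def Identifiable (G : CausalDiagram V) (Z C : Finset V) : Prop :=
  ∀ (Ω : V → Type) [∀ v, Fintype (Ω v)] (B₁ B₂ : Exogenous G) (M₁ : SCM G Ω B₁) (M₂ : SCM G Ω B₂),
    (∀ v, M₁.Q Zᶜ v = M₂.Q Zᶜ v ∧ 0 < M₁.Q Zᶜ v) → ∀ v, M₁.Q C v = M₂.Q C v

end Graph

section CausalBounds

variable {V : Type} [Fintype V] [DecidableEq V] {G : CausalDiagram V} {Ω : V → Type}
  [∀ v, Fintype (Ω v)] {B : Exogenous G} {ι : Type}

/-- The full assignment equal to `x` on `X`, to `s` on `S ∖ X` and to `w` elsewhere. -/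
def glue (X S : Finset V) (x : Assign Ω X) (s : Assign Ω S) (w : (v : V) → Ω v) : (v : V) → Ω v :=
  fun v => if h : v ∈ X then x ⟨v, h⟩ else if h' : v ∈ S then s ⟨v, h'⟩ else w v

/-- The lower bound `Q[C'](v)` for `Q[C](v)`, `C ⊆ C'`. -/
noncomputable def SCM.factorLower (M : SCM G Ω B) (C' : Finset V) (v : (a : V) → Ω a) : ℝ :=
  M.Q C' v

/-- The upper bound `Q[C'](v) + 1 - ∑_c Q[C'](v)` for `Q[C](v)`, `C ⊆ C'`. Both bounds are equal
to `Q[C](v)` when `C' = C`. -/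
noncomputable def SCM.factorUpper (M : SCM G Ω B) (C C' : Finset V) (v : (a : V) → Ω a) : ℝ :=
  M.Q C' v + 1 - ∑ c : Assign Ω C, M.Q C' (fun a => if h : a ∈ C then c ⟨a, h⟩ else v a)

/-- `κ C = (i, C')` picks, for each c-component `C` of the ancestral set `Y⁺` of `Y` in `G ∖ X`, a
source `i` and a set `C' ⊇ C` from which `Q*[C]` is to be bounded: no variable of `C` is subject to
a discrepancy in source `i`, and `Qⁱ[C']` is identifiable from an experiment conducted in source `i`.
The case `C' = C` is that of a transportable c-factor. -/
def IsChoice (G : CausalDiagram V) (Y : V) (D : ι → Finset V) (Z : ι → Finset (Finset V))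
    (X : Finset V) (κ : Finset V → ι × Finset V) : Prop :=
  ∀ C ∈ G.cComponents (G.ancestors X Y), C ⊆ (κ C).2 ∧ Disjoint C (D (κ C).1) ∧
    ∃ A ∈ Z (κ C).1, Identifiable G A (κ C).2

/-- `∑_{y⁺} y ∏_C Qⁱ[C']`, at the values `w` of the variables outside `X ∪ Y⁺`. -/
noncomputable def lowerExpr {Y : V} (r : Ω Y → ℝ) (S : ι → SCM G Ω B) (X : Finset V)
    (x : Assign Ω X) (κ : Finset V → ι × Finset V) (w : (v : V) → Ω v) : ℝ :=
  ∑ s : Assign Ω (G.ancestors X Y), r (glue X _ x s w Y) *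
    ∏ C ∈ G.cComponents (G.ancestors X Y), (S (κ C).1).factorLower (κ C).2 (glue X _ x s w)

open scoped Classical in
/-- `∑_y y min {1, ∑_{y⁺∖y} ∏_C (Qⁱ[C'] + 1 - ∑_c Qⁱ[C'])}`, at the values `w` of the variables
outside `X ∪ Y⁺`. -/
noncomputable def upperExpr {Y : V} (r : Ω Y → ℝ) (S : ι → SCM G Ω B) (X : Finset V)
    (x : Assign Ω X) (κ : Finset V → ι × Finset V) (w : (v : V) → Ω v) : ℝ :=
  ∑ o : Ω Y, r o * min 1
    (∑ s : Assign Ω (G.ancestors X Y) with glue X _ x s w Y = o,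
      ∏ C ∈ G.cComponents (G.ancestors X Y),
        (S (κ C).1).factorUpper C (κ C).2 (glue X _ x s w))

/-- The lower causal bound `ℓ_x`: the best lower expression, and `0` if there is none. -/
noncomputable def lowerCausalBound {Y : V} (r : Ω Y → ℝ) (D : ι → Finset V)
    (Z : ι → Finset (Finset V)) (S : ι → SCM G Ω B) (X : Finset V) (x : Assign Ω X) : EReal :=
  max 0 (⨆ (κ : Finset V → ι × Finset V) (_ : IsChoice G Y D Z X κ) (w : (v : V) → Ω v),
    (lowerExpr r S X x κ w : EReal))

/-- The upper causal bound `u_x`: the best upper expression, and `∞` if there is none. -/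
noncomputable def upperCausalBound {Y : V} (r : Ω Y → ℝ) (D : ι → Finset V)
    (Z : ι → Finset (Finset V)) (S : ι → SCM G Ω B) (X : Finset V) (x : Assign Ω X) : EReal :=
  ⨅ (κ : Finset V → ι × Finset V) (_ : IsChoice G Y D Z X κ) (w : (v : V) → Ω v),
    (upperExpr r S X x κ w : EReal)

/-- The largest value of `g` over all actions `do(x)`, `x ∈ Ω_X`, with `X` in the family `F`. -/
noncomputable def maxOver (F : Finset V → Prop)
    (g : (X : Finset V) → Assign Ω X → EReal) : EReal :=
  ⨆ (X : Finset V) (_ : F X) (x : Assign Ω X), g X x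

/-- The lower dominance bound `ℓ*`: the largest lower causal bound of an action on an MIS with respect
to `⟨G, Y, N⟩`. -/
noncomputable def lowerDominanceBound {Y : V} (r : Ω Y → ℝ) (D : ι → Finset V)
    (Z : ι → Finset (Finset V)) (S : ι → SCM G Ω B) (N : Finset V) : EReal :=
  maxOver (IsMIS G Y N) (lowerCausalBound r D Z S)

/-- The upper dominance bound `u*` obtained from the constraint `N`: the largest upper causal bound of
an action on a POMIS with respect to `⟨G, Y, N⟩`. -/
noncomputable def upperDominanceBound {Y : V} (r : Ω Y → ℝ) (D : ι → Finset V)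
    (Z : ι → Finset (Finset V)) (S : ι → SCM G Ω B) (N : Finset V) : EReal :=
  maxOver (IsPOMIS G Y N) (upperCausalBound r D Z S)

end CausalBounds

/-!
The theorem combines two independent facts.

*Soundness of the causal bounds.* `Q[C](v)` is the probability that `v` satisfies the structural
equations of the variables in `C` (`SCM.Q_eq_equations`). Three properties follow at once. First,
`Q[C]` depends only on the mechanisms of `C`, so it is shared by the target and every source without
a discrepancy in `C` (`SCM.DiffersOnlyOn.Q_eq`). Secondly, `Q[C'] ≤ Q[C]` for `C ⊆ C'`, and as
the numbers `Q[C]` sum to `1` over the values of `C`, also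
`Q[C] ≤ Q[C'] + 1 - ∑_c Q[C']` (`SCM.Q_le_factorUpper`). Thirdly, mechanisms of different c-components
share no exogenous variable, so the law of the ancestors of `Y` under `do(x)` is the product of
the c-factors of their c-components (`SCM.prod_Q_eq`). Bounding each factor bounds the reward from
both sides.

*Optimality of POMISs.* Every allowed set is equivalent to an MIS (`exists_isMIS`), so it is enough
to find, in a given model, a POMIS whose best action is the best action on any MIS. A model gives each
MIS `X` the value `g X = max_x E_{P_x} Y`, and `X` is a POMIS if its value is strictly the largest
in some model. The functions `g` that arise from models are closed under `g + c h`, `c ≥ 0`: run the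
two models side by side and add the rewards (`IsValueProfile.add_mul`). They also separate distinct
MISs `X` and `W` (`IsMIS.exists_valueProfile_ne`): if `v` is a last variable of their symmetric
difference in the causal order, say `v ∈ X`, then minimality of `X` yields a directed path from `v`
to `Y` that avoids `W`, and in a deterministic Boolean model a signal started at `v` reaches `Y`
while no action on `W` starts a signal that arrives there. Hence small perturbations break all ties
between the maximizers in the given model, and one of these maximizers is the only maximizer in the
perturbed model, that is, a POMIS (`exists_unique_maximizer`).
-/

set_option linter.unusedSectionVars false

/-! ### Potential responses -/

section Solve

variable {V : Type} [Fintype V] [DecidableEq V] {G : CausalDiagram V} {Ω : V → Type}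
  {B : Exogenous G}

instance (M : SCM G Ω B) : MeasureTheory.IsProbabilityMeasure M.law := by
  unfold SCM.law; infer_instance

theorem SCM.solve_of_mem (M : SCM G Ω B) {X : Finset V} (x : Assign Ω X)
    (u : (e : B.E) → B.U e) {v : V} (h : v ∈ X) : M.solve X x u v = x ⟨v, h⟩ := by
  rw [SCM.solve, WellFounded.fix_eq, dif_pos h]

theorem SCM.solve_of_notMem (M : SCM G Ω B) {X : Finset V} (x : Assign Ω X)
    (u : (e : B.E) → B.U e) {v : V} (h : v ∉ X) :
    M.solve X x u v = M.f v (fun w => M.solve X x u w.1) (fun e => u e.1) := by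
  rw [SCM.solve, WellFounded.fix_eq, dif_neg h]

/-- The domains of a model are non-empty: they contain the values of a solution. -/
theorem SCM.nonempty (M : SCM G Ω B) (v : V) : Nonempty (Ω v) := by
  obtain ⟨u⟩ := MeasureTheory.nonempty_of_isProbabilityMeasure M.law
  exact ⟨M.solve ∅ (fun a => absurd a.2 (Finset.notMem_empty _)) u v⟩

theorem SCM.measurableSet_mechanism (M : SCM G Ω B) (v : V)
    (pa : (w : {w // G.dir w v}) → Ω w) (o : Ω v) :
    MeasurableSet {u : (e : B.E) → B.U e | M.f v pa (fun e => u e.1) = o} :=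
  (measurable_pi_lambda (fun (u : (e : B.E) → B.U e) (e : {e // e ∈ B.reads v}) => u e.1)
    (fun e => measurable_pi_apply e.1)) (M.measurable_f v pa o)

theorem SCM.measurableSet_solve [∀ v, Finite (Ω v)] (M : SCM G Ω B) (X : Finset V)
    (x : Assign Ω X) (v : V) (o : Ω v) : MeasurableSet {u | M.solve X x u v = o} := by
  induction v using G.wf.induction with
  | _ v ih =>
    by_cases h : v ∈ X
    · simp only [M.solve_of_mem x _ h, MeasurableSet.const]
    · have : {u | M.solve X x u v = o} = ⋃ pa : (w : {w // G.dir w v}) → Ω w,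
          (⋂ w, {u | M.solve X x u w.1 = pa w}) ∩ {u | M.f v pa (fun e => u e.1) = o} := by
        ext u
        simp only [Set.mem_ofPred_eq, M.solve_of_notMem x u h, Set.mem_iUnion, Set.mem_inter_iff,
          Set.mem_iInter]
        constructor
        · exact fun hu => ⟨_, fun _ => rfl, hu⟩
        · rintro ⟨pa, hpa, hu⟩
          rwa [show (fun w : {w // G.dir w v} => M.solve X x u w.1) = pa from funext hpa]
      rw [this]
      exact .iUnion fun pa => (MeasurableSet.iInter
        fun w : {w // G.dir w v} => ih w.1 w.2 _).inter
        (M.measurableSet_mechanism v pa o)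

/-- If every parent of a variable of `A` lies in `A` or is fixed by the intervention to its value
under `a`, then the potential responses on `A` agree with `a` exactly when `a` satisfies the structural
equations of the variables of `A`. -/
theorem SCM.solve_eq_iff_mechanism (M : SCM G Ω B) {X : Finset V} (x : Assign Ω X)
    {A : Finset V} (hA : Disjoint A X) (a : (v : V) → Ω v)
    (hpa : ∀ v ∈ A, ∀ w, G.dir w v → w ∈ A ∨ ∃ h : w ∈ X, x ⟨w, h⟩ = a w)
    (u : (e : B.E) → B.U e) :
    (∀ v ∈ A, M.solve X x u v = a v) ↔
      ∀ v ∈ A, M.f v (fun w => a w.1) (fun e => u e.1) = a v := by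
  have parents : ∀ v ∈ A, (∀ w ∈ A, G.dir w v → M.solve X x u w = a w) →
      M.solve X x u v = M.f v (fun w => a w.1) (fun e => u e.1) := by
    intro v hv h
    rw [M.solve_of_notMem x u (Finset.disjoint_left.1 hA hv)]
    congr 1
    funext w
    obtain hw | ⟨hw, hxw⟩ := hpa v hv w.1 w.2
    · exact h _ hw w.2
    · rw [M.solve_of_mem x u hw, hxw]
  constructor
  · intro h v hv
    rw [← parents v hv fun w hw _ => h w hw, h v hv]
  · intro h v
    induction v using G.wf.induction with
    | _ v ih =>
      intro hv
      rw [parents v hv fun w hw hwv => ih w hwv hw, h v hv]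

/-- The units for which the assignment `a` satisfies the structural equations of the variables
of `A`. -/
def SCM.equations (M : SCM G Ω B) (A : Finset V) (a : (v : V) → Ω v) : Set ((e : B.E) → B.U e) :=
  {u | ∀ v ∈ A, M.f v (fun w => a w.1) (fun e => u e.1) = a v}

theorem SCM.measurableSet_equations (M : SCM G Ω B) (A : Finset V) (a : (v : V) → Ω v) :
    MeasurableSet (M.equations A a) := by
  have : M.equations A a = ⋂ v ∈ A, {u | M.f v (fun w => a w.1) (fun e => u e.1) = a v} := by
    ext u; simp [SCM.equations]
  rw [this]
  exact A.measurableSet_biInter fun v _ => M.measurableSet_mechanism v _ _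

theorem SCM.Q_eq_equations (M : SCM G Ω B) (C : Finset V) (v : (a : V) → Ω a) :
    M.Q C v = M.law.real (M.equations C v) := by
  unfold SCM.Q SCM.equations
  congr 1
  ext u
  refine M.solve_eq_iff_mechanism _ disjoint_compl_right v (fun c _ w _ => ?_) u
  by_cases h : w ∈ C
  · exact .inl h
  · exact .inr ⟨Finset.mem_compl.2 h, rfl⟩

theorem SCM.Q_nonneg (M : SCM G Ω B) (C : Finset V) (v : (a : V) → Ω a) : 0 ≤ M.Q C v :=
  MeasureTheory.measureReal_nonneg

theorem SCM.Q_anti (M : SCM G Ω B) {C C' : Finset V} (h : C ⊆ C') (v : (a : V) → Ω a) :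
    M.Q C' v ≤ M.Q C v := by
  rw [M.Q_eq_equations, M.Q_eq_equations]
  exact MeasureTheory.measureReal_mono fun u hu c hc => hu c (h hc)

end Solve

/-! ### C-factors -/

section Factor

variable {V : Type} [Fintype V] [DecidableEq V] {G : CausalDiagram V} {Ω : V → Type}
  [∀ v, Fintype (Ω v)] {B : Exogenous G}

theorem SCM.sum_Q_eq_one (M : SCM G Ω B) (C : Finset V) (v : (a : V) → Ω a) :
    ∑ c : Assign Ω C, M.Q C (fun a => if h : a ∈ C then c ⟨a, h⟩ else v a) = 1 := by
  classical
  let φ : ((e : B.E) → B.U e) → Assign Ω C := fun u c => M.solve Cᶜ (fun a => v a) u c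
  have hφ : ∀ c : Assign Ω C, M.Q C (fun a => if h : a ∈ C then c ⟨a, h⟩ else v a) =
      M.law.real (φ ⁻¹' {c}) := by
    intro c
    have hv : (fun a : {a // a ∈ Cᶜ} => if h : a.1 ∈ C then c ⟨a.1, h⟩ else v a.1) =
        fun a : {a // a ∈ Cᶜ} => v a.1 := by
      funext a
      rw [dif_neg (Finset.mem_compl.1 a.2)]
    unfold SCM.Q
    congr 1
    ext u
    simp only [hv, Set.mem_ofPred_eq, Set.mem_preimage, Set.mem_singleton_iff, φ, funext_iff,
      Subtype.forall]
    exact forall₂_congr fun a ha => by rw [dif_pos ha]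
  have hmeas : ∀ c ∈ (Finset.univ : Finset (Assign Ω C)), MeasurableSet (φ ⁻¹' {c}) := by
    intro c _
    have : φ ⁻¹' {c} = ⋂ a : C, {u | M.solve Cᶜ (fun a => v a) u a = c a} := by
      ext u; simp [φ, funext_iff]
    rw [this]
    exact .iInter fun a => M.measurableSet_solve _ _ _ _
  rw [Finset.sum_congr rfl fun c _ => hφ c,
    MeasureTheory.sum_measureReal_preimage_singleton _ hmeas]
  simp

theorem SCM.Q_le_factorUpper (M : SCM G Ω B) {C C' : Finset V} (h : C ⊆ C')
    (v : (a : V) → Ω a) : M.Q C v ≤ M.factorUpper C C' v := by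
  generalize hupd : (fun (c : Assign Ω C) (a : V) => if h : a ∈ C then c ⟨a, h⟩ else v a) = upd
  have hupd' : ∀ c : Assign Ω C, (fun a => if h : a ∈ C then c ⟨a, h⟩ else v a) = upd c :=
    fun c => congrFun hupd c
  have hself : upd (fun b : C => v b) = v := by
    rw [← hupd']
    funext a
    by_cases ha : a ∈ C <;> simp [ha]
  have hone := M.sum_Q_eq_one C v
  simp only [SCM.factorUpper, hupd'] at hone ⊢
  -- The defects `Q[C] - Q[C']` at the values of `C` are non-negative, and the defect at `v` is one
  -- of the terms of their sum.
  have key := Finset.single_le_sum (f := fun c => M.Q C (upd c) - M.Q C' (upd c))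
    (fun c _ => sub_nonneg.2 (M.Q_anti h _)) (Finset.mem_univ fun b : C => v b)
  simp only [hself, Finset.sum_sub_distrib, hone] at key
  linarith

end Factor

section Locality

variable {V : Type} [Fintype V] [DecidableEq V] {G : CausalDiagram V} {Ω : V → Type}
  {B : Exogenous G}

open scoped Classical in
/-- The exogenous variables that are arguments of a mechanism of `A`. -/
noncomputable def Exogenous.readBy (B : Exogenous G) (A : Finset V) : Finset B.E :=
  Finset.univ.filter fun e => ∃ v ∈ A, e ∈ B.reads v

theorem Exogenous.mem_readBy {A : Finset V} {v : V} (hv : v ∈ A) {e : B.E} (he : e ∈ B.reads v) :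
    e ∈ B.readBy A := by
  classical
  exact Finset.mem_filter.2 ⟨Finset.mem_univ _, v, hv, he⟩

/-- `SCM.equations` in terms of the exogenous variables that it depends on. -/
def SCM.localEquations (M : SCM G Ω B) (A : Finset V) (a : (v : V) → Ω v) :
    Set ((e : B.readBy A) → B.U e) :=
  {u | ∀ v (hv : v ∈ A),
    M.f v (fun w => a w.1) (fun e => u ⟨e.1, Exogenous.mem_readBy hv e.2⟩) = a v}

theorem SCM.equations_eq_preimage (M : SCM G Ω B) (A : Finset V) (a : (v : V) → Ω v) :
    M.equations A a =
      (fun (u : (e : B.E) → B.U e) (e : B.readBy A) => u e) ⁻¹' M.localEquations A a := rfl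

theorem SCM.measurableSet_localEquations (M : SCM G Ω B) (A : Finset V) (a : (v : V) → Ω v) :
    MeasurableSet (M.localEquations A a) := by
  have : M.localEquations A a = ⋂ v, ⋂ hv : v ∈ A, {u | M.f v (fun w => a w.1)
      (fun e => u ⟨e.1, Exogenous.mem_readBy hv e.2⟩) = a v} := by
    ext u; simp [SCM.localEquations]
  rw [this]
  refine .iInter fun v => .iInter fun hv => ?_
  exact (measurable_pi_lambda (fun (u : (e : B.readBy A) → B.U e) (e : {e // e ∈ B.reads v}) =>
    u ⟨e.1, Exogenous.mem_readBy hv e.2⟩) (fun e => measurable_pi_apply _))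
      (M.measurable_f v _ _)

theorem SCM.measurePreserving_restrict (M : SCM G Ω B) (R : Finset B.E) :
    MeasureTheory.MeasurePreserving (fun (u : (e : B.E) → B.U e) (e : R) => u e) M.law
      (MeasureTheory.Measure.pi fun e : R => M.P e) := by
  classical
  convert MeasureTheory.measurePreserving_fst.comp
    (MeasureTheory.measurePreserving_piEquivPiSubtypeProd M.P (· ∈ R)) using 1
  · rfl
  · rfl
  · congr!

/-- C-factors transport: `Q[C]` depends only on the mechanisms of the variables in `C`. -/
theorem SCM.DiffersOnlyOn.Q_eq {M T : SCM G Ω B} {D C : Finset V} (h : M.DiffersOnlyOn T D)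
    (hC : Disjoint C D) (v : (a : V) → Ω a) : M.Q C v = T.Q C v := by
  have hD : ∀ c ∈ C, c ∉ D := fun c hc => Finset.disjoint_left.1 hC hc
  have hP : (fun e : B.readBy C => M.P e) = fun e : B.readBy C => T.P e := by
    classical
    funext e
    obtain ⟨c, hc, he⟩ := (Finset.mem_filter.1 e.2).2
    exact (h c (hD c hc)).2 e he
  have hf : M.localEquations C v = T.localEquations C v := by
    ext u
    exact forall₂_congr fun c hc => by rw [(h c (hD c hc)).1]
  rw [M.Q_eq_equations, T.Q_eq_equations, M.equations_eq_preimage, T.equations_eq_preimage,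
    (M.measurePreserving_restrict _).measureReal_preimage
      (M.measurableSet_localEquations _ _).nullMeasurableSet,
    (T.measurePreserving_restrict _).measureReal_preimage
      (T.measurableSet_localEquations _ _).nullMeasurableSet, hP, hf]

theorem Exogenous.disjoint_readBy (B : Exogenous G) {A A' : Finset V}
    (h : ∀ v ∈ A, ∀ w ∈ A', v ≠ w ∧ ¬ G.bi v w) : Disjoint (B.readBy A) (B.readBy A') := by
  classical
  rw [Finset.disjoint_left]
  intro e he he'
  obtain ⟨v, hv, hev⟩ := (Finset.mem_filter.1 he).2
  obtain ⟨w, hw, hew⟩ := (Finset.mem_filter.1 he').2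
  exact (h v hv w hw).2 (B.share v w e (h v hv w hw).1 hev hew)

theorem SCM.real_equations_union (M : SCM G Ω B) {A A' : Finset V}
    (h : ∀ v ∈ A, ∀ w ∈ A', v ≠ w ∧ ¬ G.bi v w) (a : (v : V) → Ω v) :
    M.law.real (M.equations (A ∪ A') a) =
      M.law.real (M.equations A a) * M.law.real (M.equations A' a) := by
  have hunion : M.equations (A ∪ A') a = M.equations A a ∩ M.equations A' a := by
    ext u
    simp only [SCM.equations, Finset.mem_union, or_imp, forall_and, Set.mem_ofPred_eq,
      Set.mem_inter_iff]
  have hindep := ProbabilityTheory.iIndepFun.indepFun_finset (B.readBy A) (B.readBy A')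
    (B.disjoint_readBy h)
    (ProbabilityTheory.iIndepFun_pi (μ := M.P) (X := fun _ => id) fun _ => aemeasurable_id)
    (fun e => measurable_pi_apply e)
  have := hindep.measure_inter_preimage_eq_mul _ _ (M.measurableSet_localEquations A a)
    (M.measurableSet_localEquations A' a)
  rw [hunion, MeasureTheory.measureReal_def, MeasureTheory.measureReal_def,
    MeasureTheory.measureReal_def, ← ENNReal.toReal_mul]
  exact congrArg ENNReal.toReal this

/-- Structural equations of sets without bidirected edges between them are independent events. -/
theorem SCM.real_equations_biUnion (M : SCM G Ω B) (t : Finset (Finset V))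
    (h : ∀ C ∈ t, ∀ C' ∈ t, C ≠ C' → ∀ v ∈ C, ∀ w ∈ C', v ≠ w ∧ ¬ G.bi v w)
    (a : (v : V) → Ω v) :
    M.law.real (M.equations (t.biUnion id) a) = ∏ C ∈ t, M.law.real (M.equations C a) := by
  induction t using Finset.induction_on with
  | empty => simp [SCM.equations]
  | insert C t hC ih =>
    rw [Finset.biUnion_insert, Finset.prod_insert hC, ← ih fun C₁ h₁ C₂ h₂ =>
      h C₁ (Finset.mem_insert_of_mem h₁) C₂ (Finset.mem_insert_of_mem h₂)]
    refine M.real_equations_union (fun v hv w hw => ?_) a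
    obtain ⟨C', hC', hw⟩ := Finset.mem_biUnion.1 hw
    exact h C (Finset.mem_insert_self _ _) C' (Finset.mem_insert_of_mem hC')
      (fun e => hC (e ▸ hC')) v hv w hw

theorem CausalDiagram.biUnion_cComponents (G : CausalDiagram V) (A : Finset V) :
    (G.cComponents A).biUnion id = A := by
  classical
  ext v
  simp only [CausalDiagram.cComponents, Finset.mem_biUnion, Finset.mem_image, id]
  constructor
  · rintro ⟨_, ⟨w, _, rfl⟩, hv⟩
    exact (Finset.mem_filter.1 hv).1
  · exact fun hv => ⟨_, ⟨v, hv, rfl⟩, Finset.mem_filter.2 ⟨hv, .refl⟩⟩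

theorem CausalDiagram.cComponents_separated (G : CausalDiagram V) (A : Finset V) :
    ∀ C ∈ G.cComponents A, ∀ C' ∈ G.cComponents A, C ≠ C' →
      ∀ v ∈ C, ∀ w ∈ C', v ≠ w ∧ ¬ G.bi v w := by
  classical
  simp only [CausalDiagram.cComponents, Finset.mem_image]
  rintro _ ⟨c, hc, rfl⟩ _ ⟨c', hc', rfl⟩ hne v hv w hw
  obtain ⟨hvA, hv⟩ := Finset.mem_filter.1 hv
  obtain ⟨hwA, hw⟩ := Finset.mem_filter.1 hw
  have hsymm : Std.Symm (fun a b => G.bi a b ∧ a ∈ A ∧ b ∈ A) :=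
    ⟨fun a b h => ⟨G.bi_symm _ _ h.1, h.2.2, h.2.1⟩⟩
  have swap : ∀ {a b}, Relation.ReflTransGen (fun a b => G.bi a b ∧ a ∈ A ∧ b ∈ A) a b →
      Relation.ReflTransGen (fun a b => G.bi a b ∧ a ∈ A ∧ b ∈ A) b a :=
    fun h => Std.Symm.symm _ _ h
  have conn : ¬ Relation.ReflTransGen (fun a b => G.bi a b ∧ a ∈ A ∧ b ∈ A) v w := by
    intro h
    apply hne
    have hcc' := (hv.trans h).trans (swap hw)
    ext z
    simp only [Finset.mem_filter, and_congr_right_iff]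
    exact fun _ => ⟨fun hz => (swap hcc').trans hz, fun hz => hcc'.trans hz⟩
  exact ⟨fun e => conn (e ▸ .refl), fun h => conn (.single ⟨h, hvA, hwA⟩)⟩

end Locality

/-! ### Soundness of the causal bounds -/

section Bounds

variable {V : Type} [Fintype V] [DecidableEq V] {G : CausalDiagram V} {Ω : V → Type}
  [∀ v, Fintype (Ω v)] {B : Exogenous G} {Y : V}

theorem CausalDiagram.mem_ancestors {X : Finset V} {v : V} :
    v ∈ G.ancestors X Y ↔ Relation.ReflTransGen (fun a b => G.dir a b ∧ a ∉ X) v Y := by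
  simp [CausalDiagram.ancestors]

theorem CausalDiagram.disjoint_ancestors (G : CausalDiagram V) {X : Finset V} (hY : Y ∉ X) :
    Disjoint (G.ancestors X Y) X := by
  rw [Finset.disjoint_left]
  intro v hv hvX
  obtain rfl | ⟨w, hw, _⟩ := (G.mem_ancestors.1 hv).cases_head
  · exact hY hvX
  · exact hw.2 hvX

theorem CausalDiagram.mem_ancestors_or_of_dir {X : Finset V} {v w : V}
    (hv : v ∈ G.ancestors X Y) (h : G.dir w v) : w ∈ G.ancestors X Y ∨ w ∈ X := by
  by_cases hw : w ∈ X
  · exact .inr hw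
  · exact .inl (G.mem_ancestors.2 (.head ⟨h, hw⟩ (G.mem_ancestors.1 hv)))

/-- The truncated factorization: the law of the ancestors of `Y` under `do(x)` is the product of
the c-factors of the c-components that they induce. -/
theorem SCM.prod_Q_eq (M : SCM G Ω B) {X : Finset V} (hY : Y ∉ X) (x : Assign Ω X)
    (s : Assign Ω (G.ancestors X Y)) (w : (v : V) → Ω v) :
    ∏ C ∈ G.cComponents (G.ancestors X Y), M.Q C (glue X _ x s w) =
      M.law.real ((fun u (v : G.ancestors X Y) => M.solve X x u v) ⁻¹' {s}) := by
  have hdisj := G.disjoint_ancestors hY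
  simp only [M.Q_eq_equations]
  rw [← M.real_equations_biUnion _ (G.cComponents_separated _), G.biUnion_cComponents]
  congr 1
  ext u
  refine (M.solve_eq_iff_mechanism x hdisj _ (fun v hv p hp => ?_) u).symm.trans ?_
  · obtain h | h := CausalDiagram.mem_ancestors_or_of_dir hv hp
    · exact .inl h
    · exact .inr ⟨h, by simp [glue, h]⟩
  · simp only [Set.mem_preimage, Set.mem_singleton_iff, funext_iff, Subtype.forall]
    exact forall₂_congr fun v hv => by
      rw [glue, dif_neg (Finset.disjoint_left.1 hdisj hv), dif_pos hv]

theorem CausalDiagram.self_mem_ancestors (G : CausalDiagram V) (X : Finset V) :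
    Y ∈ G.ancestors X Y :=
  G.mem_ancestors.2 .refl

open scoped Classical in
/-- The law of `Y` under `do(x)` in terms of c-factors. -/
theorem SCM.real_solve_eq (M : SCM G Ω B) {X : Finset V} (hY : Y ∉ X) (x : Assign Ω X)
    (w : (v : V) → Ω v) (o : Ω Y) :
    M.law.real {u | M.solve X x u Y = o} =
      ∑ s : Assign Ω (G.ancestors X Y) with glue X _ x s w Y = o,
        ∏ C ∈ G.cComponents (G.ancestors X Y), M.Q C (glue X _ x s w) := by
  rw [Finset.sum_congr rfl fun s _ => M.prod_Q_eq hY x s w,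
    MeasureTheory.sum_measureReal_preimage_singleton]
  · congr 1
    ext u
    simp [glue, hY, G.self_mem_ancestors X]
  · intro s _
    have : (fun u (v : G.ancestors X Y) => M.solve X x u v) ⁻¹' {s} =
        ⋂ v : G.ancestors X Y, {u | M.solve X x u v = s v} := by
      ext u; simp [funext_iff]
    rw [this]
    exact .iInter fun v => M.measurableSet_solve _ _ _ _

variable {ι : Type} {D : ι → Finset V} {Z : ι → Finset (Finset V)} {T : SCM G Ω B}
  {S : ι → SCM G Ω B} {r : Ω Y → ℝ}

/-- For an admissible choice, each c-factor of the target is the same in the chosen source, where it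
lies between the two bounds. -/
theorem IsChoice.Q_bounds (hS : ∀ i, (S i).DiffersOnlyOn T (D i)) {X : Finset V}
    {κ : Finset V → ι × Finset V} (hκ : IsChoice G Y D Z X κ) {C : Finset V}
    (hC : C ∈ G.cComponents (G.ancestors X Y)) (v : (a : V) → Ω a) :
    (S (κ C).1).factorLower (κ C).2 v ≤ T.Q C v ∧
      T.Q C v ≤ (S (κ C).1).factorUpper C (κ C).2 v := by
  obtain ⟨hsub, hdisj, _⟩ := hκ C hC
  rw [← (hS _).Q_eq hdisj v]
  exact ⟨(S _).Q_anti hsub v, (S _).Q_le_factorUpper hsub v⟩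

theorem lowerExpr_le_reward (hr : ∀ o, 0 ≤ r o) (hS : ∀ i, (S i).DiffersOnlyOn T (D i))
    {X : Finset V} (hY : Y ∉ X) (x : Assign Ω X) {κ : Finset V → ι × Finset V}
    (hκ : IsChoice G Y D Z X κ) (w : (v : V) → Ω v) :
    lowerExpr r S X x κ w ≤ T.reward r X x := by
  classical
  unfold lowerExpr SCM.reward
  rw [← Finset.sum_fiberwise Finset.univ
    (fun s : Assign Ω (G.ancestors X Y) => glue X _ x s w Y)]
  refine Finset.sum_le_sum fun o _ => ?_
  rw [T.real_solve_eq hY x w o, Finset.mul_sum]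
  refine Finset.sum_le_sum fun s hs => ?_
  rw [(Finset.mem_filter.1 hs).2]
  exact mul_le_mul_of_nonneg_left (Finset.prod_le_prod (fun C _ => (S _).Q_nonneg _ _)
    fun C hC => (hκ.Q_bounds hS hC _).1) (hr o)

theorem reward_le_upperExpr (hr : ∀ o, 0 ≤ r o) (hS : ∀ i, (S i).DiffersOnlyOn T (D i))
    {X : Finset V} (hY : Y ∉ X) (x : Assign Ω X) {κ : Finset V → ι × Finset V}
    (hκ : IsChoice G Y D Z X κ) (w : (v : V) → Ω v) :
    T.reward r X x ≤ upperExpr r S X x κ w := by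
  classical
  unfold upperExpr SCM.reward
  refine Finset.sum_le_sum fun o _ => mul_le_mul_of_nonneg_left (le_min ?_ ?_) (hr o)
  · exact MeasureTheory.measureReal_le_one
  · rw [T.real_solve_eq hY x w o]
    exact Finset.sum_le_sum fun s _ => Finset.prod_le_prod (fun C _ => T.Q_nonneg _ _)
      fun C hC => (hκ.Q_bounds hS hC _).2

theorem lowerCausalBound_le_reward (hr : ∀ o, 0 ≤ r o)
    (hS : ∀ i, (S i).DiffersOnlyOn T (D i)) {X : Finset V} (hY : Y ∉ X) (x : Assign Ω X) :
    lowerCausalBound r D Z S X x ≤ (T.reward r X x : EReal) := by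
  refine max_le ?_ (iSup_le fun κ => iSup_le fun hκ => iSup_le fun w => ?_)
  · exact EReal.coe_nonneg.2 (Finset.sum_nonneg fun o _ =>
      mul_nonneg (hr o) MeasureTheory.measureReal_nonneg)
  · exact EReal.coe_le_coe_iff.2 (lowerExpr_le_reward hr hS hY x hκ w)

theorem reward_le_upperCausalBound (hr : ∀ o, 0 ≤ r o)
    (hS : ∀ i, (S i).DiffersOnlyOn T (D i)) {X : Finset V} (hY : Y ∉ X) (x : Assign Ω X) :
    (T.reward r X x : EReal) ≤ upperCausalBound r D Z S X x :=
  le_iInf fun _ => le_iInf fun hκ => le_iInf fun w =>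
    EReal.coe_le_coe_iff.2 (reward_le_upperExpr hr hS hY x hκ w)

end Bounds

/-! ### Sums of models -/

section Combine

variable {V : Type} [Fintype V] [DecidableEq V] {G : CausalDiagram V}

theorem SCM.integrable_comp_solve {Ω : V → Type} [∀ v, Fintype (Ω v)] {B : Exogenous G}
    (M : SCM G Ω B) {Y : V} (r : Ω Y → ℝ) (X : Finset V) (x : Assign Ω X) :
    MeasureTheory.Integrable (fun u => r (M.solve X x u Y)) M.law ∧
      M.reward r X x = ∫ u, r (M.solve X x u Y) ∂M.law := by
  have h : (fun u => r (M.solve X x u Y)) =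
      fun u => ∑ o, {u | M.solve X x u Y = o}.indicator (fun _ => r o) u := by
    classical
    funext u
    simp [Set.indicator_apply]
  have hint : ∀ o ∈ (Finset.univ : Finset (Ω Y)), MeasureTheory.Integrable
      ({u | M.solve X x u Y = o}.indicator fun _ => r o) M.law := fun o _ =>
    (MeasureTheory.integrable_const _).indicator (M.measurableSet_solve X x Y o)
  rw [h]
  refine ⟨MeasureTheory.integrable_finsetSum _ hint, ?_⟩
  rw [MeasureTheory.integral_finsetSum _ hint]
  refine Finset.sum_congr rfl fun o _ => ?_
  rw [MeasureTheory.integral_indicator_const _ (M.measurableSet_solve X x Y o), smul_eq_mul,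
    mul_comm]

/-- The exogenous side of two models run side by side, independently of each other. -/
def Exogenous.sum (B₀ B₁ : Exogenous G) : Exogenous G where
  E := B₀.E ⊕ B₁.E
  U := Sum.elim B₀.U B₁.U
  measurableU e := match e with
    | .inl e => B₀.measurableU e
    | .inr e => B₁.measurableU e
  reads v := {e | Sum.elim (· ∈ B₀.reads v) (· ∈ B₁.reads v) e}
  share v w e := match e with
    | .inl e => B₀.share v w e
    | .inr e => B₁.share v w e

variable {Ω₀ Ω₁ : V → Type} [∀ v, Fintype (Ω₀ v)] [∀ v, Fintype (Ω₁ v)] {B₀ B₁ : Exogenous G}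

/-- Two models run side by side: each variable is the pair of its values in the two models. -/
def SCM.prod (M₀ : SCM G Ω₀ B₀) (M₁ : SCM G Ω₁ B₁) :
    SCM G (fun v => Ω₀ v × Ω₁ v) (B₀.sum B₁) where
  P e := match e with
    | .inl e => M₀.P e
    | .inr e => M₁.P e
  prob e := match e with
    | .inl e => M₀.prob e
    | .inr e => M₁.prob e
  f v pa u := (M₀.f v (fun w => (pa w).1) (fun e => u ⟨.inl e.1, e.2⟩),
    M₁.f v (fun w => (pa w).2) (fun e => u ⟨.inr e.1, e.2⟩))
  measurable_f v pa o := by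
    have h₀ : Measurable (fun (u : (e : {e // e ∈ (B₀.sum B₁).reads v}) → (B₀.sum B₁).U e.1)
        (e : {e // e ∈ B₀.reads v}) => (u ⟨.inl e.1, e.2⟩ : B₀.U e.1)) :=
      measurable_pi_lambda _ fun e => measurable_pi_apply
        (⟨.inl e.1, e.2⟩ : {e // e ∈ (B₀.sum B₁).reads v})
    have h₁ : Measurable (fun (u : (e : {e // e ∈ (B₀.sum B₁).reads v}) → (B₀.sum B₁).U e.1)
        (e : {e // e ∈ B₁.reads v}) => (u ⟨.inr e.1, e.2⟩ : B₁.U e.1)) :=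
      measurable_pi_lambda _ fun e => measurable_pi_apply
        (⟨.inr e.1, e.2⟩ : {e // e ∈ (B₀.sum B₁).reads v})
    simp only [Prod.ext_iff]
    exact (h₀ (M₀.measurable_f v (fun w => (pa w).1) o.1)).inter
      (h₁ (M₁.measurable_f v (fun w => (pa w).2) o.2))

/-- The first component of a unit of two models run side by side. -/
def Exogenous.sumFst (u : (e : (B₀.sum B₁).E) → (B₀.sum B₁).U e) (e : B₀.E) : B₀.U e :=
  u (.inl e : B₀.E ⊕ B₁.E)

/-- The second component of a unit of two models run side by side. -/
def Exogenous.sumSnd (u : (e : (B₀.sum B₁).E) → (B₀.sum B₁).U e) (e : B₁.E) : B₁.U e :=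
  u (.inr e : B₀.E ⊕ B₁.E)

theorem SCM.prod_solve (M₀ : SCM G Ω₀ B₀) (M₁ : SCM G Ω₁ B₁) (X : Finset V)
    (x : Assign (fun v => Ω₀ v × Ω₁ v) X) (u : (e : (B₀.sum B₁).E) → (B₀.sum B₁).U e) (v : V) :
    (M₀.prod M₁).solve X x u v =
      (M₀.solve X (fun a => (x a).1) (Exogenous.sumFst u) v,
        M₁.solve X (fun a => (x a).2) (Exogenous.sumSnd u) v) := by
  induction v using G.wf.induction with
  | _ v ih =>
    by_cases h : v ∈ X
    · rw [SCM.solve_of_mem _ _ _ h, SCM.solve_of_mem _ _ _ h, SCM.solve_of_mem _ _ _ h]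
    · have hpa : (fun w : {w // G.dir w v} => (M₀.prod M₁).solve X x u w.1) =
          fun w : {w // G.dir w v} => (M₀.solve X (fun a => (x a).1) (Exogenous.sumFst u) w.1,
            M₁.solve X (fun a => (x a).2) (Exogenous.sumSnd u) w.1) :=
        funext fun w => ih w.1 w.2
      rw [SCM.solve_of_notMem _ _ _ h, SCM.solve_of_notMem _ _ _ h,
        SCM.solve_of_notMem _ _ _ h, hpa]
      rfl

theorem SCM.measurePreserving_prod (M₀ : SCM G Ω₀ B₀) (M₁ : SCM G Ω₁ B₁) :
    MeasureTheory.MeasurePreserving (fun u => (Exogenous.sumFst u, Exogenous.sumSnd u))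
      (M₀.prod M₁).law (M₀.law.prod M₁.law) := by
  have hprob : ∀ e : B₀.E ⊕ B₁.E, MeasureTheory.SigmaFinite ((M₀.prod M₁).P e) := fun e =>
    have := (M₀.prod M₁).prob e
    inferInstance
  exact MeasureTheory.measurePreserving_sumPiEquivProdPi (X := (B₀.sum B₁).U) (M₀.prod M₁).P

/-- In the product model, a weighted sum of the rewards has the weighted sum of the expectations. -/
theorem SCM.prod_reward (M₀ : SCM G Ω₀ B₀) (M₁ : SCM G Ω₁ B₁) {Y : V} (r₀ : Ω₀ Y → ℝ)
    (r₁ : Ω₁ Y → ℝ) (c : ℝ) (X : Finset V) (x : Assign (fun v => Ω₀ v × Ω₁ v) X) :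
    (M₀.prod M₁).reward (fun o : Ω₀ Y × Ω₁ Y => r₀ o.1 + c * r₁ o.2) X x =
      M₀.reward r₀ X (fun a => (x a).1) + c * M₁.reward r₁ X (fun a => (x a).2) := by
  obtain ⟨hi₀, he₀⟩ := M₀.integrable_comp_solve r₀ X (fun a => (x a).1)
  obtain ⟨hi₁, he₁⟩ := M₁.integrable_comp_solve r₁ X (fun a => (x a).2)
  have hp₀ : MeasureTheory.MeasurePreserving Exogenous.sumFst (M₀.prod M₁).law M₀.law :=
    MeasureTheory.measurePreserving_fst.comp (M₀.measurePreserving_prod M₁)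
  have hp₁ : MeasureTheory.MeasurePreserving Exogenous.sumSnd (M₀.prod M₁).law M₁.law :=
    MeasureTheory.measurePreserving_snd.comp (M₀.measurePreserving_prod M₁)
  have hadd := MeasureTheory.integral_add (hp₀.integrable_comp_of_integrable hi₀)
    ((hp₁.integrable_comp_of_integrable hi₁).const_mul c)
  rw [MeasureTheory.integral_const_mul] at hadd
  rw [((M₀.prod M₁).integrable_comp_solve _ X x).2, he₀, he₁, ← hp₀.map_eq, ← hp₁.map_eq,
    MeasureTheory.integral_map hp₀.aemeasurable (hp₀.map_eq ▸ hi₀.aestronglyMeasurable),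
    MeasureTheory.integral_map hp₁.aemeasurable (hp₁.map_eq ▸ hi₁.aestronglyMeasurable)]
  simp only [SCM.prod_solve]
  exact hadd

end Combine

/-! ### Minimal intervention sets -/

section Minimal

variable {V : Type} [Fintype V] [DecidableEq V] {G : CausalDiagram V} {Y : V} {N : Finset V}

/-- Every allowed set is equivalent to a minimal intervention set. -/
theorem exists_isMIS {X : Finset V} (hX : Allowed Y N X) :
    ∃ (W : Finset V) (h : W ⊆ X), IsMIS G Y N W ∧ EquivalentIn G Y W X h := by
  induction X using Finset.strongInduction with
  | _ X ih =>
    by_cases hmin : IsMIS G Y N X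
    · exact ⟨X, subset_rfl, hmin, fun Ω _ B M r x => rfl⟩
    · unfold IsMIS at hmin
      push Not at hmin
      obtain ⟨X', hss, heq⟩ := hmin hX
      obtain ⟨W, hW, hmis, hWeq⟩ := ih X' hss
        ⟨fun h => hX.1 (hss.subset h), hX.2.mono_left hss.subset⟩
      exact ⟨W, hW.trans hss.subset, hmis, fun Ω _ B M r x =>
        (heq Ω B M r x).trans (hWeq Ω B M r _)⟩

/-- From each variable of a minimal intervention set a directed path leads to `Y` that does not
return to the set. -/
theorem IsMIS.reach {X : Finset V} (hX : IsMIS G Y N X) {v : V} (hv : v ∈ X) :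
    Relation.ReflTransGen (fun a b => G.dir a b ∧ b ∉ X) v Y := by
  by_contra hnot
  refine hX.2 (X.erase v) (Finset.erase_ssubset hv) fun Ω _ B M r x => ?_
  -- Off `X`, the ancestors of `Y` do not respond to the intervention on `v`.
  have key : ∀ (u : (e : B.E) → B.U e) (w : V), w ∉ X →
      Relation.ReflTransGen (fun a b => G.dir a b ∧ b ∉ X) w Y →
      M.solve X x u w = M.solve (X.erase v)
        (fun a => x ⟨a.1, (Finset.erase_ssubset hv).subset a.2⟩) u w := by
    intro u w
    induction w using G.wf.induction with
    | _ w ih =>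
      intro hw hreach
      rw [M.solve_of_notMem x u hw, M.solve_of_notMem _ u fun h => hw (Finset.mem_of_mem_erase h)]
      congr 1
      funext p
      have hp : Relation.ReflTransGen (fun a b => G.dir a b ∧ b ∉ X) p.1 Y :=
        .head ⟨p.2, hw⟩ hreach
      by_cases hpX : p.1 ∈ X
      · have hpv : p.1 ≠ v := fun e => hnot (e ▸ hp)
        rw [M.solve_of_mem x u hpX, M.solve_of_mem _ u (Finset.mem_erase.2 ⟨hpv, hpX⟩)]
      · exact ih p.1 p.2 hpX hp
  simp only [SCM.reward, key _ Y hX.1.1 .refl]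

/-- The exogenous side of a deterministic model. -/
def Exogenous.none (G : CausalDiagram V) : Exogenous G where
  E := PEmpty
  U := PEmpty.elim
  measurableU e := e.elim
  reads _ := ∅
  share _ _ e := e.elim

open scoped Classical in
/-- The model without exogenous variables in which every variable is Boolean, and true exactly when
one of its parents outside `W` is true. -/
noncomputable def orModel (G : CausalDiagram V) (W : Finset V) :
    SCM G (fun _ => Bool) (Exogenous.none G) where
  P e := e.elim
  prob e := e.elim
  f v pa _ := decide (∃ p : {p // G.dir p v}, p.1 ∉ W ∧ pa p = true)
  measurable_f _ _ _ := .const _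

theorem orModel_reward_eq_zero {W : Finset V} (hY : Y ∉ W) (w : Assign (fun _ => Bool) W) :
    (orModel G W).reward (Y := Y) (fun o => if o then 1 else 0) W w = 0 := by
  classical
  have key : ∀ u v, v ∉ W → (orModel G W).solve W w u v = false := by
    intro u v
    induction v using G.wf.induction with
    | _ v ih =>
      intro hv
      rw [SCM.solve_of_notMem _ _ _ hv]
      refine decide_eq_false ?_
      rintro ⟨p, hp, hpt⟩
      exact Bool.false_ne_true ((ih p.1 p.2 hp).symm.trans hpt)
  simp [SCM.reward, key _ Y hY]

theorem orModel_reward_eq_one {X W : Finset V} {v : V} (hv : v ∈ X)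
    (hpath : Relation.ReflTransGen (fun a b => G.dir a b ∧ b ∉ X ∧ a ∉ W) v Y) :
    (orModel G W).reward (Y := Y) (fun o => if o then 1 else 0) X (fun _ => true) = 1 := by
  classical
  have key : ∀ u, (orModel G W).solve X (fun _ => true) u Y = true := by
    intro u
    induction hpath with
    | refl => rw [SCM.solve_of_mem _ _ _ hv]
    | @tail b c _ hbc ih =>
      rw [SCM.solve_of_notMem _ _ _ hbc.2.1]
      exact decide_eq_true ⟨⟨b, hbc.1⟩, hbc.2.2, ih⟩
  simp [SCM.reward, key]

/-- If `v ∈ X ∖ W` has no descendant in `W ∖ X`, then the signal that an action on `X` starts at `v`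
reaches `Y` on a path that avoids `W`. -/
theorem IsMIS.orModel_reward {X W : Finset V} (hX : IsMIS G Y N X) {v : V} (hv : v ∈ X)
    (hvW : v ∉ W) (hlast : ∀ b, Relation.TransGen G.dir v b → b ∉ X → b ∉ W) :
    (orModel G W).reward (Y := Y) (fun o => if o then 1 else 0) X (fun _ => true) = 1 := by
  refine orModel_reward_eq_one hv ?_
  suffices h : ∀ y, Relation.ReflTransGen (fun a b => G.dir a b ∧ b ∉ X) v y →
      y ∉ W ∧ Relation.ReflTransGen G.dir v y ∧
        Relation.ReflTransGen (fun a b => G.dir a b ∧ b ∉ X ∧ a ∉ W) v y from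
    (h Y (hX.reach hv)).2.2
  intro y hy
  induction hy with
  | refl => exact ⟨hvW, .refl, .refl⟩
  | @tail b c _ hbc ih =>
    obtain ⟨hb, hvb, hpath⟩ := ih
    exact ⟨hlast c (.tail' hvb hbc.1) hbc.2, hvb.tail hbc.1, hpath.tail ⟨hbc.1, hbc.2, hb⟩⟩

/-- The values `g X = max_x E_{P_x} Y` of the intervention sets in some model with diagram `G`. -/
def IsValueProfile (G : CausalDiagram V) (Y : V) (g : Finset V → ℝ) : Prop :=
  ∃ (Ω : V → Type) (_ : ∀ v, Fintype (Ω v)) (B : Exogenous G) (M : SCM G Ω B) (r : Ω Y → ℝ),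
    ∀ X, IsGreatest (Set.range (M.reward r X)) (g X)

theorem SCM.exists_isValueProfile {Ω : V → Type} [hΩ : ∀ v, Fintype (Ω v)] {B : Exogenous G}
    (M : SCM G Ω B) (r : Ω Y → ℝ) :
    ∃ g, IsValueProfile G Y g ∧ ∀ X, IsGreatest (Set.range (M.reward r X)) (g X) := by
  have h : ∀ X : Finset V, ∃ y, IsGreatest (Set.range (M.reward r X)) y := by
    intro X
    have := M.nonempty
    obtain ⟨y, hy⟩ := (Set.finite_range (M.reward r X)).exists_maximal (Set.range_nonempty _)
    exact ⟨y, hy.prop, fun z hz => (le_total z y).elim id fun h => hy.le_of_ge hz h⟩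
  choose g hg using h
  exact ⟨g, ⟨Ω, hΩ, B, M, r, hg⟩, hg⟩

theorem IsValueProfile.add_mul {g h : Finset V → ℝ} (hg : IsValueProfile G Y g)
    (hh : IsValueProfile G Y h) {c : ℝ} (hc : 0 ≤ c) :
    IsValueProfile G Y (fun X => g X + c * h X) := by
  obtain ⟨Ω₀, _, B₀, M₀, r₀, hg⟩ := hg
  obtain ⟨Ω₁, _, B₁, M₁, r₁, hh⟩ := hh
  refine ⟨fun v => Ω₀ v × Ω₁ v, fun v => inferInstance, B₀.sum B₁, M₀.prod M₁,
    fun o => r₀ o.1 + c * r₁ o.2, fun X => ⟨?_, ?_⟩⟩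
  · obtain ⟨x₀, hx₀⟩ := (hg X).1
    obtain ⟨x₁, hx₁⟩ := (hh X).1
    exact ⟨fun a => (x₀ a, x₁ a), by rw [SCM.prod_reward, hx₀, hx₁]⟩
  · rintro _ ⟨x, rfl⟩
    rw [SCM.prod_reward]
    exact add_le_add ((hg X).2 ⟨_, rfl⟩) (mul_le_mul_of_nonneg_left ((hh X).2 ⟨_, rfl⟩) hc)

theorem IsMIS.exists_valueProfile_lt {X W : Finset V} (hX : IsMIS G Y N X) (hW : IsMIS G Y N W)
    {v : V} (hv : v ∈ X) (hvW : v ∉ W)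
    (hlast : ∀ b, Relation.TransGen G.dir v b → b ∉ X → b ∉ W) :
    ∃ g, IsValueProfile G Y g ∧ g W < g X := by
  obtain ⟨g, hg, hmax⟩ := (orModel G W).exists_isValueProfile (Y := Y)
    (fun o => if o then 1 else 0)
  refine ⟨g, hg, ?_⟩
  have h₁ := (hmax X).2 ⟨_, hX.orModel_reward hv hvW hlast⟩
  obtain ⟨w, hw⟩ := (hmax W).1
  rw [orModel_reward_eq_zero hW.1.1] at hw
  linarith

/-- Distinct minimal intervention sets have different values in some model. -/
theorem IsMIS.exists_valueProfile_ne {X W : Finset V} (hX : IsMIS G Y N X) (hW : IsMIS G Y N W)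
    (hne : X ≠ W) : ∃ g, IsValueProfile G Y g ∧ g X ≠ g W := by
  have hirr : Std.Irrefl (Function.swap (Relation.TransGen G.dir)) := ⟨G.acyclic⟩
  have htrans : IsTrans V (Function.swap (Relation.TransGen G.dir)) := ⟨fun _ _ _ h h' => h'.trans h⟩
  -- A variable of the symmetric difference without descendants in it.
  obtain ⟨v, hv, hlast⟩ :=
    (Finite.wellFounded_of_trans_of_irrefl (Function.swap (Relation.TransGen G.dir))).has_min
      {v | ¬ (v ∈ X ↔ v ∈ W)} (by
        by_contra h
        rw [Set.not_nonempty_iff_eq_empty, Set.eq_empty_iff_forall_notMem] at h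
        exact hne (Finset.ext fun v => not_not.1 (h v)))
  have hlast' : ∀ b, Relation.TransGen G.dir v b → (b ∈ X ↔ b ∈ W) :=
    fun b hb => not_not.1 fun h => hlast b h hb
  by_cases hvX : v ∈ X
  · obtain ⟨g, hg, hlt⟩ := hX.exists_valueProfile_lt hW hvX (fun h => hv (by simp [hvX, h]))
      fun b hb hbX hbW => hbX ((hlast' b hb).2 hbW)
    exact ⟨g, hg, hlt.ne'⟩
  · have hvW : v ∈ W := by
      by_contra h
      exact hv (by simp [hvX, h])
    obtain ⟨g, hg, hlt⟩ := hW.exists_valueProfile_lt hX hvW hvX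
      fun b hb hbW hbX => hbW ((hlast' b hb).1 hbX)
    exact ⟨g, hg, hlt.ne⟩

end Minimal

/-! ### Breaking ties -/

/-- Let `C` be a set of real functions on `F` that is closed under adding small positive multiples
and separates the points of `F`. Then the maximum over `F` of any member of `C` is attained
at a point where some member of `C` has its only maximum: perturb the given function until
the set of its maximizers, which can only shrink, is a singleton. -/
theorem exists_unique_maximizer {α : Type*} (F : Finset α) (hF : F.Nonempty)
    (C : (α → ℝ) → Prop)
    (hadd : ∀ g h, C g → C h → ∀ c : ℝ, 0 < c → C (fun a => g a + c * h a))
    (hsep : ∀ a ∈ F, ∀ b ∈ F, a ≠ b → ∃ h, C h ∧ h a ≠ h b) (g : α → ℝ) (hg : C g) :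
    ∃ a ∈ F, (∀ b ∈ F, g b ≤ g a) ∧ ∃ h, C h ∧ ∀ b ∈ F, b ≠ a → h b < h a := by
  classical
  induction hn : (F.filter fun a => ∀ b ∈ F, g b ≤ g a).card using Nat.strong_induction_on
    generalizing g with
  | _ n ih =>
    obtain ⟨a, ha, hmax⟩ := F.exists_max_image g hF
    by_cases huniq : ∀ b ∈ F, b ≠ a → g b < g a
    · exact ⟨a, ha, hmax, g, hg, huniq⟩
    push Not at huniq
    obtain ⟨b, hb, hba, hgb⟩ := huniq
    have hgab : g a = g b := le_antisymm hgb (hmax b hb)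
    obtain ⟨h, hh, hne⟩ := hsep a ha b hb hba.symm
    have hlim : ∀ k : α, Filter.Tendsto (fun c : ℝ => g k + c * h k) (nhdsWithin 0 (Set.Ioi 0))
        (nhds (g k)) := by
      intro k
      have : Filter.Tendsto (fun c : ℝ => g k + c * h k) (nhds 0) (nhds (g k + 0 * h k)) :=
        Continuous.tendsto (by fun_prop) 0
      rw [zero_mul, add_zero] at this
      exact this.mono_left nhdsWithin_le_nhds
    have hsmall : ∀ᶠ c : ℝ in nhdsWithin 0 (Set.Ioi 0),
        ∀ k ∈ F, g k < g a → g k + c * h k < g a + c * h a := by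
      rw [Filter.eventually_all_finset]
      intro k _
      by_cases hk : g k < g a
      · filter_upwards [(hlim k).eventually_lt (hlim a) hk] with c hc _ using hc
      · exact .of_forall fun c h => absurd h hk
    obtain ⟨c, hc, hcpos⟩ := (hsmall.and self_mem_nhdsWithin).exists
    replace hcpos : 0 < c := hcpos
    -- A maximizer of the perturbed function is a maximizer of `g`.
    have hsub : ∀ k ∈ F, (∀ l ∈ F, g l + c * h l ≤ g k + c * h k) → ∀ l ∈ F, g l ≤ g k := by
      intro k hk hkmax l hl
      by_contra hlt
      exact absurd (hkmax a ha) (not_le.2 (hc k hk ((not_le.1 hlt).trans_le (hmax l hl))))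
    have hlt : (F.filter fun k => ∀ l ∈ F, g l + c * h l ≤ g k + c * h k).card < n := by
      rw [← hn]
      refine Finset.card_lt_card (Finset.ssubset_iff_subset_ne.2 ⟨fun k hk => ?_, fun heq => ?_⟩)
      · obtain ⟨hkF, hk⟩ := Finset.mem_filter.1 hk
        exact Finset.mem_filter.2 ⟨hkF, hsub k hkF hk⟩
      · -- The perturbation separates the tied points `a` and `b`.
        have ha' : a ∈ F.filter fun k => ∀ l ∈ F, g l + c * h l ≤ g k + c * h k :=
          heq ▸ Finset.mem_filter.2 ⟨ha, hmax⟩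
        have hb' : b ∈ F.filter fun k => ∀ l ∈ F, g l + c * h l ≤ g k + c * h k :=
          heq ▸ Finset.mem_filter.2 ⟨hb, fun l hl => hgab ▸ hmax l hl⟩
        have h₁ := (Finset.mem_filter.1 ha').2 b hb
        have h₂ := (Finset.mem_filter.1 hb').2 a ha
        exact hne (mul_left_cancel₀ hcpos.ne' (by linarith))
    obtain ⟨k, hk, hkmax, hh'⟩ := ih _ hlt _ (hadd g h hg hh c hcpos) rfl
    exact ⟨k, hk, hsub k hk hkmax, hh'⟩

/-! ### Optimality of POMISs and the dominance bounds -/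

section Dominance

variable {V : Type} [Fintype V] [DecidableEq V] {G : CausalDiagram V} {Y : V} {Ω : V → Type}
  [∀ v, Fintype (Ω v)] {B : Exogenous G}

/-- In every model, each allowed action is matched or beaten by an action on a POMIS. -/
theorem SCM.exists_isPOMIS_reward_le (M : SCM G Ω B) (r : Ω Y → ℝ) {N X : Finset V}
    (hX : Allowed Y N X) (x : Assign Ω X) :
    ∃ (W : Finset V) (w : Assign Ω W), IsPOMIS G Y N W ∧ M.reward r X x ≤ M.reward r W w := by
  classical
  obtain ⟨X', hX', hmis, heq⟩ := exists_isMIS (G := G) hX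
  obtain ⟨g, hg, hmax⟩ := M.exists_isValueProfile r
  obtain ⟨W, hW, hWmax, h, hh, hWuniq⟩ := exists_unique_maximizer
    (Finset.univ.filter (IsMIS G Y N)) ⟨X', by simpa using hmis⟩ (IsValueProfile G Y)
    (fun _ _ h₁ h₂ _ hc => h₁.add_mul h₂ hc.le)
    (fun A hA A' hA' hne => (Finset.mem_filter.1 hA).2.exists_valueProfile_ne
      (Finset.mem_filter.1 hA').2 hne) g hg
  obtain ⟨w, hw⟩ := (hmax W).1
  refine ⟨W, w, ⟨(Finset.mem_filter.1 hW).2, ?_⟩, ?_⟩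
  · obtain ⟨Ω', hΩ', B', M', r', hmax'⟩ := hh
    obtain ⟨w', hw'⟩ := (hmax' W).1
    refine ⟨Ω', hΩ', B', M', r', w', fun A hA hne a => ?_⟩
    rw [hw']
    exact ((hmax' A).2 ⟨a, rfl⟩).trans_lt (hWuniq A (by simpa using hA) hne)
  · rw [hw, heq Ω B M r x]
    exact ((hmax X').2 ⟨_, rfl⟩).trans (hWmax X' (by simpa using hmis))

theorem SCM.maxOver_isPOMIS_eq (M : SCM G Ω B) (r : Ω Y → ℝ) (N : Finset V) :
    maxOver (IsPOMIS G Y N) (fun X x => (M.reward r X x : EReal)) =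
      maxOver (Allowed Y N) (fun X x => (M.reward r X x : EReal)) := by
  refine le_antisymm (biSup_mono fun X hX => hX.1.1) ?_
  refine iSup_le fun X => iSup_le fun hX => iSup_le fun x => ?_
  obtain ⟨W, w, hW, hle⟩ := M.exists_isPOMIS_reward_le r hX x
  exact (EReal.coe_le_coe_iff.2 hle).trans
    (le_iSup_of_le W (le_iSup_of_le hW (le_iSup_of_le w le_rfl)))

/-- Relaxing the constraint and replacing each POMIS by an equivalent superset do not lower the
optimal reward. -/
theorem SCM.maxOver_allowed_le (M : SCM G Ω B) (r : Ω Y → ℝ) {N N' : Finset V} (hN : N ⊆ N')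
    {F : Finset V → Prop}
    (hF : ∀ R', IsPOMIS G Y N R' → ∃ R, F R ∧ IsPOISOver G Y N R R')
    {g : (X : Finset V) → Assign Ω X → EReal}
    (hg : ∀ X x, Y ∉ X → (M.reward r X x : EReal) ≤ g X x) :
    maxOver (Allowed Y N') (fun X x => (M.reward r X x : EReal)) ≤ maxOver F g := by
  refine iSup_le fun X => iSup_le fun hX => iSup_le fun x => ?_
  obtain ⟨W, w, hW, hle⟩ := M.exists_isPOMIS_reward_le r ⟨hX.1, hX.2.mono_right hN⟩ x
  obtain ⟨R, hR, hallowed, _, _, hsub, heq⟩ := hF W hW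
  let x' : Assign Ω R := fun a => if h : a.1 ∈ W then w ⟨a, h⟩ else (M.nonempty a.1).some
  have hx' : (fun a : {a // a ∈ W} => x' ⟨a.1, hsub a.2⟩) = w := by
    funext a
    simp [x']
  have hrew : M.reward r R x' = M.reward r W w := by rw [heq Ω B M r x', hx']
  exact (EReal.coe_le_coe_iff.2 (hle.trans hrew.ge)).trans ((hg R x' hallowed.1).trans
    (le_iSup_of_le R (le_iSup_of_le hR (le_iSup_of_le x' le_rfl))))

end Dominance

theorem mainTheorem3 {V : Type} [Fintype V] [DecidableEq V] (G : CausalDiagram V) (Y : V)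
    (Ω : V → Type) [∀ v, Fintype (Ω v)] (r : Ω Y → ℝ) (hr : ∀ o, 0 ≤ r o)
    (B : Exogenous G) {ι : Type} [Fintype ι] (D : ι → Finset V) (Z : ι → Finset (Finset V))
    (T : SCM G Ω B) (S : ι → SCM G Ω B) (hS : ∀ i, (S i).DiffersOnlyOn T (D i))
    (Nstar : Finset V) :
    lowerDominanceBound r D Z S Nstar ≤
        maxOver (IsPOMIS G Y Nstar) (fun X x => (T.reward r X x : EReal)) ∧
      maxOver (IsPOMIS G Y Nstar) (fun X x => (T.reward r X x : EReal)) =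
        maxOver (Allowed Y Nstar) (fun X x => (T.reward r X x : EReal)) ∧
      ∀ N, N ⊆ Nstar →
        maxOver (Allowed Y Nstar) (fun X x => (T.reward r X x : EReal)) ≤
            upperDominanceBound r D Z S N ∧
          ∀ F : Finset V → Prop,
            (∀ R', IsPOMIS G Y N R' → ∃ R, F R ∧ IsPOISOver G Y N R R') →
            maxOver (Allowed Y Nstar) (fun X x => (T.reward r X x : EReal)) ≤
              maxOver F (upperCausalBound r D Z S) := by
  have hupper : ∀ X x, Y ∉ X → (T.reward r X x : EReal) ≤ upperCausalBound r D Z S X x :=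
    fun X x hY => reward_le_upperCausalBound hr hS hY x
  refine ⟨?_, T.maxOver_isPOMIS_eq r Nstar, fun N hN => ⟨?_, fun F hF =>
    T.maxOver_allowed_le r hN hF hupper⟩⟩
  · rw [T.maxOver_isPOMIS_eq r Nstar]
    refine iSup_le fun W => iSup_le fun hW => iSup_le fun w => ?_
    exact (lowerCausalBound_le_reward hr hS hW.1.1 w).trans
      (le_iSup_of_le W (le_iSup_of_le hW.1 (le_iSup_of_le w le_rfl)))
  · have hmono : maxOver (Allowed Y Nstar) (fun X x => (T.reward r X x : EReal)) ≤
        maxOver (Allowed Y N) (fun X x => (T.reward r X x : EReal)) :=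
      biSup_mono fun X hX => ⟨hX.1, hX.2.mono_right hN⟩
    rw [← T.maxOver_isPOMIS_eq r N] at hmono
    exact hmono.trans (iSup_mono fun R => iSup_mono fun hR => iSup_mono fun x =>
      hupper R x hR.1.1.1)
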